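/- Let $H$ be a complex Hilbert space of finite or infinite dimension, $B(H)$ the ring of bounded linear operators on $H$, and $F(H)$ the two-sided ideal of $B(H)$ consisting of the operators with finite-dimensional range. A multiplicative semigroup $\mathcal S\subseteq B(H)$ is a subset closed under products; an ideal of $\mathcal S$ is a subset $J\subseteq\mathcal S$ such that $XT\in J$ and $TX\in J$ for all $T\in J$ and $X\in\mathcal S$; and $\mathcal S$ is called a selfadjoint-ideal (SI) semigroup if every ideal $J$ of $\mathcal S$ satisfies $T^*\in J$ for all $T\in J$. Every two-sided ideal of the ring $B(H)$ is regarded as a semigroup under multiplication. Then: 1. $F(H)$ is an SI semigroup. 2. If $H$ is separable, then no nonzero proper two-sided ideal of the ring $B(H)$ other than $F(H)$ is an SI semigroup. 3. For arbitrary $H$ (not necessarily separable), no nonzero two-sided ideal of the ring $B(H)$ that consists of compact operators and is different from $F(H)$ is an SI semigroup. -/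

import Mathlib

/-- `J` is a (two-sided) semigroup ideal of the multiplicative subsemigroup `S`: a subset of `S`
with `X * T ∈ J` and `T * X ∈ J` for all `T ∈ J` and `X ∈ S`. -/
structure IsSemigroupIdeal {A : Type*} [Mul A] (S : Subsemigroup A) (J : Set A) : Prop where
  subset : J ⊆ (S : Set A)
  mul_left_mem : ∀ X ∈ S, ∀ T ∈ J, X * T ∈ J
  mul_right_mem : ∀ X ∈ S, ∀ T ∈ J, T * X ∈ J

/-- `S` is a selfadjoint-ideal (SI) semigroup: each of its semigroup ideals is closed under
adjoints. -/
def IsSISemigroup {A : Type*} [Mul A] [Star A] (S : Subsemigroup A) : Prop :=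
  ∀ J : Set A, IsSemigroupIdeal S J → ∀ T ∈ J, star T ∈ J

/-- A two-sided ideal of a ring, viewed as a multiplicative semigroup. -/
def TwoSidedIdeal.toMulSubsemigroup {A : Type*} [Ring A] (I : TwoSidedIdeal A) :
    Subsemigroup A where
  carrier := {T | T ∈ I}
  mul_mem' := fun {a b} _ hb => I.mul_mem_left a b hb

/-- The two-sided ideal `F(H)` of `B(H)` of bounded operators with finite-dimensional range. -/
def finiteRankIdeal (H : Type*) [NormedAddCommGroup H] [InnerProductSpace ℂ H] :
    TwoSidedIdeal (H →L[ℂ] H) :=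
  TwoSidedIdeal.mk' {T | FiniteDimensional ℂ (LinearMap.range (T : H →ₗ[ℂ] H))}
    (by
      have h : LinearMap.range ((0 : H →L[ℂ] H) : H →ₗ[ℂ] H) = ⊥ := by
        simp
      show FiniteDimensional ℂ _
      rw [h]; infer_instance)
    (by
      intro S T hS hT
      simp only [Set.mem_ofPred_eq] at hS hT ⊢
      refine Submodule.finiteDimensional_of_le
        (S₂ := LinearMap.range (S : H →ₗ[ℂ] H) ⊔ LinearMap.range (T : H →ₗ[ℂ] H)) ?_
      rintro _ ⟨x, rfl⟩
      exact Submodule.add_mem_sup ⟨x, rfl⟩ ⟨x, rfl⟩)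
    (by
      intro T hT
      simp only [Set.mem_ofPred_eq] at hT ⊢
      refine Submodule.finiteDimensional_of_le (S₂ := LinearMap.range (T : H →ₗ[ℂ] H)) ?_
      rintro _ ⟨x, rfl⟩
      exact ⟨-x, by simp⟩)
    (by
      intro S T hT
      simp only [Set.mem_ofPred_eq] at hT ⊢
      refine Submodule.finiteDimensional_of_le
        (S₂ := (LinearMap.range (T : H →ₗ[ℂ] H)).map (S : H →ₗ[ℂ] H)) ?_
      rintro _ ⟨x, rfl⟩
      exact ⟨T x, ⟨x, rfl⟩, rfl⟩)
    (by
      intro S T hS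
      simp only [Set.mem_ofPred_eq] at hS ⊢
      refine Submodule.finiteDimensional_of_le (S₂ := LinearMap.range (S : H →ₗ[ℂ] H)) ?_
      rintro _ ⟨x, rfl⟩
      exact ⟨T x, rfl⟩)

theorem mem_finiteRankIdeal {H : Type*} [NormedAddCommGroup H] [InnerProductSpace ℂ H]
    (T : H →L[ℂ] H) :
    T ∈ finiteRankIdeal H ↔ FiniteDimensional ℂ (LinearMap.range (T : H →ₗ[ℂ] H)) := by
  simp [finiteRankIdeal]

/-! For `T` of finite rank, `T* = T* T S` with `S` of finite rank, so `T*` lies in every semigroup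
ideal of `F(H)` containing `T`. Let `I` be an SI ideal of compact operators and `T ∈ I` not
selfadjoint. The principal semigroup ideal of `T` contains `T*`, say `T* = X T Y`; substituting the
adjoint equation gives `T* = A T* B` with `A = X Y*`, `B = X* Y` compact. The map `Z ↦ A Z B` is
compact, so its fixed space `E` is finite-dimensional, and left multiplication by `A` is injective
on `E`. Its minimal polynomial then has nonzero constant term, so `A q T* = T*` for some `q`, and
the range of `T*` lies in the finite-dimensional fixed space of the compact `A q`
(`mem_finiteRankIdeal_of_mul_mul_eq`). Hence `I = F(H)`. On separable `H`, an ideal with a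
noncompact element is everything (`eq_top_of_not_isCompactOperator`), so the second claim reduces to
the third. -/

theorem isCompactOperator_of_finiteDimensional_range {E F : Type*} [NormedAddCommGroup E]
    [NormedSpace ℂ E] [NormedAddCommGroup F] [NormedSpace ℂ F] (T : E →L[ℂ] F)
    (hT : FiniteDimensional ℂ (LinearMap.range (T : E →ₗ[ℂ] F))) : IsCompactOperator T := by
  have : ProperSpace (LinearMap.range (T : E →ₗ[ℂ] F)) := FiniteDimensional.proper ℂ _
  have h := (isCompactOperator_id (E := LinearMap.range (T : E →ₗ[ℂ] F))).comp_clm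
    (T.codRestrict (LinearMap.range (T : E →ₗ[ℂ] F)) fun x => ⟨x, rfl⟩)
  exact h.clm_comp (LinearMap.range (T : E →ₗ[ℂ] F)).subtypeL

theorem finiteDimensional_fixedPoints_of_isCompactOperator {E : Type*} [NormedAddCommGroup E]
    [NormedSpace ℂ E] {T : E →L[ℂ] E} (hT : IsCompactOperator T) :
    FiniteDimensional ℂ (Module.End.eigenspace (T : E →ₗ[ℂ] E) 1) := by
  set V := Module.End.eigenspace (T : E →ₗ[ℂ] E) 1
  have hV : ∀ x, x ∈ V ↔ T x = x := fun x => by simp [V]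
  have hclosed : IsClosed (V : Set E) := by
    have : (V : Set E) = {x | T x = x} := Set.ext hV
    rw [this]
    exact isClosed_eq T.continuous continuous_id
  rw [← isCompactOperator_id_iff_finiteDimensional (𝕜 := ℂ)]
  have h := (hT.comp_clm V.subtypeL).codRestrict (V := V)
    (fun x => by simp [(hV x).1 x.2]) hclosed
  have e : (id : V → V) = Set.codRestrict (T ∘ V.subtypeL) V
      (fun x => by simp [(hV x).1 x.2]) :=
    funext fun x => Subtype.ext ((hV x).1 x.2).symm
  rwa [e]

theorem isCompactOperator_of_forall_approx {E F : Type*} [NormedAddCommGroup E]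
    [NormedSpace ℂ E] [NormedAddCommGroup F] [NormedSpace ℂ F] [CompleteSpace F] {T : E →L[ℂ] F}
    (h : ∀ ε > 0, ∃ S : E →L[ℂ] F, IsCompactOperator S ∧ ‖T - S‖ ≤ ε) : IsCompactOperator T := by
  have hc := isClosed_setOfPred_isCompactOperator (σ₁₂ := RingHom.id ℂ) (M₁ := E) (M₂ := F)
  have : T ∈ closure {f : E →L[ℂ] F | IsCompactOperator f} := by
    rw [Metric.mem_closure_iff]
    intro ε hε
    obtain ⟨S, hS, hle⟩ := h (ε / 2) (by positivity)
    exact ⟨S, hS, by rw [dist_eq_norm]; linarith⟩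
  rwa [hc.closure_eq] at this

/-! ### Finite-rank approximation and orthogonality. -/

section Hilbert

variable {H : Type*} [NormedAddCommGroup H] [InnerProductSpace ℂ H]

theorem IsCompactOperator.exists_finiteRank_approx {T : H →L[ℂ] H}
    (hT : IsCompactOperator T) {ε : ℝ} (hε : 0 < ε) :
    ∃ S ∈ finiteRankIdeal H, ‖T - S‖ ≤ ε := by
  have hK := hT.isCompact_closure_image_closedBall (f := (T : H →ₗ[ℂ] H)) 1
  obtain ⟨t, -, htf, ht⟩ := hK.finite_cover_balls hε
  let V : Submodule ℂ H := Submodule.span ℂ t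
  have : FiniteDimensional ℂ V := FiniteDimensional.span_of_finite ℂ htf
  -- `V` is spanned by a finite `ε`-net of the image of the unit ball.
  refine ⟨V.starProjection * T, ?_, ?_⟩
  · rw [mem_finiteRankIdeal]
    refine Submodule.finiteDimensional_of_le (S₂ := V) ?_
    rintro _ ⟨x, rfl⟩
    simp
  · refine ContinuousLinearMap.opNorm_le_of_unit_norm hε.le fun x hx => ?_
    have hmem : T x ∈ closure ((T : H →ₗ[ℂ] H) '' Metric.closedBall 0 1) :=
      subset_closure ⟨x, by simp [hx], rfl⟩
    obtain ⟨v, hv, hxv⟩ := Set.mem_iUnion₂.1 (ht hmem)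
    rw [mem_ball_iff_norm] at hxv
    have : ‖T x - V.starProjection (T x)‖ ≤ ‖T x - v‖ := by
      rw [Submodule.starProjection_minimal]
      exact ciInf_le ⟨0, by rintro _ ⟨y, rfl⟩; positivity⟩ (⟨v, Submodule.subset_span hv⟩ : V)
    simpa using this.trans hxv.le

theorem norm_sum_sq_of_pairwise_inner_eq_zero {ι : Type*} {v : ι → H}
    (hv : Pairwise fun i j => inner ℂ (v i) (v j) = 0) (s : Finset ι) :
    ‖∑ i ∈ s, v i‖ ^ 2 = ∑ i ∈ s, ‖v i‖ ^ 2 := by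
  classical
  induction s using Finset.induction_on with
  | empty => simp
  | insert a s ha ih =>
    rw [Finset.sum_insert ha, Finset.sum_insert ha, ← ih, sq, sq, sq]
    refine norm_add_sq_eq_norm_sq_add_norm_sq_of_inner_eq_zero _ _ (𝕜 := ℂ) ?_
    rw [inner_sum]
    exact Finset.sum_eq_zero fun i hi => hv fun h => ha (h ▸ hi)

theorem Orthonormal.countable_of_separableSpace [TopologicalSpace.SeparableSpace H] {ι : Type*}
    {v : ι → H} (hv : Orthonormal ℂ v) : Countable ι := by
  rw [← Set.countable_univ_iff]
  refine Set.PairwiseDisjoint.countable_of_isOpen (s := fun i => Metric.ball (v i) (1 / 2))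
    (fun i _ j _ hij => Metric.ball_disjoint_ball ?_) (fun _ _ => Metric.isOpen_ball)
    fun i _ => ⟨v i, by simp⟩
  have h : ‖v i - v j‖ ^ 2 = 2 := by
    rw [@norm_sub_sq ℂ, hv.1, hv.1, hv.2 hij]
    norm_num
  rw [dist_eq_norm]
  nlinarith [norm_nonneg (v i - v j)]

theorem exists_norm_eq_one_mem_orthogonal {T : H →L[ℂ] H} {ε : ℝ} (hε : 0 < ε)
    (hT : ∀ S : H →L[ℂ] H, IsCompactOperator S → ε < ‖T - S‖) (V : Submodule ℂ H)
    [FiniteDimensional ℂ V] : ∃ y ∈ Vᗮ, ‖y‖ = 1 ∧ ε ≤ ‖T y‖ := by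
  by_contra! h
  have hc : IsCompactOperator (V.starProjection : H →L[ℂ] H) := by
    refine isCompactOperator_of_finiteDimensional_range _
      (Submodule.finiteDimensional_of_le (S₂ := V) ?_)
    rintro _ ⟨x, rfl⟩
    simp
  have hV : ∀ y ∈ Vᗮ, ‖T y‖ ≤ ε * ‖y‖ := by
    intro y hy
    rcases eq_or_ne y 0 with rfl | hy0
    · simp
    have hn : ‖y‖ ≠ 0 := norm_ne_zero_iff.2 hy0
    have := h (((‖y‖⁻¹ : ℝ) : ℂ) • y) (Submodule.smul_mem _ _ hy) (by simp [norm_smul, hn])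
    rw [map_smul, norm_smul, Complex.norm_real, norm_inv, norm_norm, inv_mul_eq_div,
      div_lt_iff₀ (by positivity)] at this
    exact this.le
  -- Otherwise `T` is within `ε` of the compact operator `T P`, where `P` projects onto `V`.
  refine (hT (T * V.starProjection) (hc.clm_comp T)).not_ge
    (ContinuousLinearMap.opNorm_le_bound _ hε.le fun x => ?_)
  have e : (T - T * V.starProjection) x = T (Vᗮ.starProjection x) := by
    simp [Submodule.starProjection_orthogonal_val]
  rw [e]
  refine (hV _ (Submodule.starProjection_apply_mem _ _)).trans ?_
  gcongr
  exact Submodule.norm_starProjection_apply_le _ _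

/-! ### Adjoints and the SI property of `F(H)`. -/

variable [CompleteSpace H]

theorem adjoint_mul_starProjection_range (T : H →L[ℂ] H)
    [(LinearMap.range (T : H →ₗ[ℂ] H)).HasOrthogonalProjection] :
    star T * (LinearMap.range (T : H →ₗ[ℂ] H)).starProjection = star T := by
  have h : (LinearMap.range (T : H →ₗ[ℂ] H)).starProjection * T = T := by
    ext x
    exact Submodule.starProjection_eq_self_iff.2 ⟨x, rfl⟩
  have hs : star (LinearMap.range (T : H →ₗ[ℂ] H)).starProjection =
      (LinearMap.range (T : H →ₗ[ℂ] H)).starProjection :=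
    isSelfAdjoint_starProjection _
  conv_rhs => rw [← h, star_mul, hs]

theorem star_mem_finiteRankIdeal {T : H →L[ℂ] H} (hT : T ∈ finiteRankIdeal H) :
    star T ∈ finiteRankIdeal H := by
  rw [mem_finiteRankIdeal] at hT
  rw [← adjoint_mul_starProjection_range T]
  refine (finiteRankIdeal H).mul_mem_left _ _ ?_
  rw [mem_finiteRankIdeal]
  refine Submodule.finiteDimensional_of_le (S₂ := LinearMap.range (T : H →ₗ[ℂ] H)) ?_
  rintro _ ⟨x, rfl⟩
  simp

theorem IsCompactOperator.star {T : H →L[ℂ] H} (hT : IsCompactOperator T) :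
    IsCompactOperator (star T : H →L[ℂ] H) := by
  refine isCompactOperator_of_forall_approx fun ε hε => ?_
  obtain ⟨S, hS, hle⟩ := hT.exists_finiteRank_approx hε
  refine ⟨Star.star S, isCompactOperator_of_finiteDimensional_range _
    ((mem_finiteRankIdeal _).1 (star_mem_finiteRankIdeal hS)), ?_⟩
  rwa [← star_sub, norm_star]

/-- For `T` of finite rank, `T* T S = T*` with `S` the pseudoinverse of `T`. -/
theorem exists_star_mul_mul_eq_star {T : H →L[ℂ] H} (hT : T ∈ finiteRankIdeal H) :
    ∃ S ∈ finiteRankIdeal H, star T * T * S = star T := by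
  have hT' := (mem_finiteRankIdeal T).1 hT
  obtain ⟨g, hg⟩ := (T : H →ₗ[ℂ] H).rangeRestrict.exists_rightInverse_of_surjective
    (LinearMap.range_eq_top.2 (LinearMap.surjective_rangeRestrict _))
  let V := LinearMap.range (T : H →ₗ[ℂ] H)
  -- `g` is a linear section of `T` over its range, so `T S` is the projection onto the range.
  refine ⟨LinearMap.toContinuousLinearMap g ∘L V.orthogonalProjectionOnto, ?_, ?_⟩
  · rw [mem_finiteRankIdeal]
    refine Submodule.finiteDimensional_of_le (S₂ := LinearMap.range g) ?_
    rintro _ ⟨x, rfl⟩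
    exact ⟨_, rfl⟩
  · conv_rhs => rw [← adjoint_mul_starProjection_range T]
    rw [mul_assoc]
    congr 1
    ext x
    have := congrArg Subtype.val (LinearMap.congr_fun hg (V.orthogonalProjectionOnto x))
    simpa using this

theorem isSISemigroup_finiteRankIdeal : IsSISemigroup (finiteRankIdeal H).toMulSubsemigroup := by
  intro J hJ T hT
  have hTF : T ∈ finiteRankIdeal H := hJ.subset hT
  obtain ⟨S, hS, h⟩ := exists_star_mul_mul_eq_star hTF
  rw [← h]
  exact hJ.mul_right_mem _ hS _ (hJ.mul_left_mem _ (star_mem_finiteRankIdeal hTF) _ hT)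

/-! ### Fixed points of two-sided multiplications. -/

/-- The two-sided multiplication `Z ↦ A Z B` by compact operators is compact. -/
theorem isCompactOperator_mulLeftRight {A B : H →L[ℂ] H} (hA : IsCompactOperator A)
    (hB : IsCompactOperator B) :
    IsCompactOperator (ContinuousLinearMap.mulLeftRight ℂ (H →L[ℂ] H) A B) := by
  have key : ∀ F ∈ finiteRankIdeal H, ∀ G ∈ finiteRankIdeal H,
      IsCompactOperator (ContinuousLinearMap.mulLeftRight ℂ (H →L[ℂ] H) F G) := by
    intro F hF G hG
    rw [mem_finiteRankIdeal] at hF hG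
    let V := LinearMap.range (F : H →ₗ[ℂ] H)
    let W := LinearMap.range (G : H →ₗ[ℂ] H)
    let F' : H →L[ℂ] V := F.codRestrict V fun x => ⟨x, rfl⟩
    let G' : H →L[ℂ] W := G.codRestrict W fun x => ⟨x, rfl⟩
    let Ψ : (W →L[ℂ] V) →ₗ[ℂ] (H →L[ℂ] H) :=
      { toFun := fun Z => V.subtypeL ∘L Z ∘L G'
        map_add' := fun _ _ => by ext; simp
        map_smul' := fun _ _ => by ext; simp }
    -- `F Z G` depends only on a map `W → V`, and these form a finite-dimensional space.
    refine isCompactOperator_of_finiteDimensional_range _ ?_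
    refine Submodule.finiteDimensional_of_le (S₂ := LinearMap.range Ψ) ?_
    rintro _ ⟨Z, rfl⟩
    exact ⟨F' ∘L Z ∘L W.subtypeL, by ext x; rfl⟩
  refine isCompactOperator_of_forall_approx fun ε hε => ?_
  obtain ⟨F, hF, hFA⟩ := hA.exists_finiteRank_approx
    (show 0 < ε / (2 * (‖B‖ + 1)) by positivity)
  obtain ⟨G, hG, hGB⟩ := hB.exists_finiteRank_approx
    (show 0 < ε / (2 * (‖F‖ + 1)) by positivity)
  refine ⟨_, key F hF G hG, ContinuousLinearMap.opNorm_le_bound _ hε.le fun Z => ?_⟩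
  have e : (ContinuousLinearMap.mulLeftRight ℂ (H →L[ℂ] H) A B -
      ContinuousLinearMap.mulLeftRight ℂ (H →L[ℂ] H) F G) Z =
      (A - F) * Z * B + F * Z * (B - G) := by
    simp only [sub_apply, ContinuousLinearMap.mulLeftRight_apply]
    noncomm_ring
  rw [e]
  have h1 : ‖A - F‖ * ‖B‖ ≤ ε / 2 := by
    calc ‖A - F‖ * ‖B‖ ≤ ε / (2 * (‖B‖ + 1)) * (‖B‖ + 1) := by gcongr; linarith
      _ = ε / 2 := by field_simp
  have h2 : ‖F‖ * ‖B - G‖ ≤ ε / 2 := by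
    calc ‖F‖ * ‖B - G‖ ≤ (‖F‖ + 1) * (ε / (2 * (‖F‖ + 1))) := by gcongr; linarith
      _ = ε / 2 := by field_simp
  calc ‖(A - F) * Z * B + F * Z * (B - G)‖
      ≤ ‖A - F‖ * ‖Z‖ * ‖B‖ + ‖F‖ * ‖Z‖ * ‖B - G‖ :=
        (norm_add_le _ _).trans (add_le_add (norm_mul₃_le) (norm_mul₃_le))
    _ = (‖A - F‖ * ‖B‖ + ‖F‖ * ‖B - G‖) * ‖Z‖ := by ring
    _ ≤ ε * ‖Z‖ := by gcongr; linarith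

theorem exists_mul_aeval_mul_eq {A B T : H →L[ℂ] H} (hA : IsCompactOperator A)
    (hB : IsCompactOperator B) (h : A * T * B = T) :
    ∃ q : H →L[ℂ] H, A * q * T = T := by
  let L := ContinuousLinearMap.mulLeftRight ℂ (H →L[ℂ] H) A B
  let E := Module.End.eigenspace (L : (H →L[ℂ] H) →ₗ[ℂ] (H →L[ℂ] H)) 1
  have hE : ∀ Z, Z ∈ E ↔ A * Z * B = Z := fun Z => by
    simp [E, L]
  have : FiniteDimensional ℂ E :=
    finiteDimensional_fixedPoints_of_isCompactOperator (isCompactOperator_mulLeftRight hA hB)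
  let Λ : Module.End ℂ E := (LinearMap.mulLeft ℂ A).restrict (p := E) (q := E) fun Z hZ => by
    rw [hE] at hZ ⊢
    rw [LinearMap.mulLeft_apply, mul_assoc A (A * Z), hZ]
  have hΛ : ∀ Z : E, (Λ Z : H →L[ℂ] H) = A * Z := fun Z => rfl
  -- `A Z = 0` forces `Z = A Z B = 0`.
  have hinj : Function.Injective Λ := by
    rw [injective_iff_map_eq_zero]
    intro Z hZ
    have h0 : A * (Z : H →L[ℂ] H) = 0 := by rw [← hΛ, hZ]; rfl
    ext1
    rw [← (hE Z).1 Z.2, h0, zero_mul]; rfl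
  have haeval : ∀ (p : Polynomial ℂ) (Z : E),
      (Polynomial.aeval Λ p Z : H →L[ℂ] H) = Polynomial.aeval A p * Z := by
    intro p
    induction p using Polynomial.induction_on' with
    | add p q hp hq => intro Z; simp [hp, hq, add_mul]
    | monomial n a =>
      intro Z
      have : ∀ n : ℕ, ((Λ ^ n) Z : H →L[ℂ] H) = A ^ n * Z := by
        intro n
        induction n with
        | zero => simp
        | succ n ih => rw [pow_succ', Module.End.mul_apply, hΛ, ih, pow_succ', mul_assoc]
      simp [Polynomial.aeval_monomial, this, Algebra.algebraMap_eq_smul_one]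
  set p := minpoly ℂ Λ
  have hc : p.coeff 0 ≠ 0 := by
    intro h0
    have := (Module.End.hasEigenvalue_iff_isRoot (f := Λ) (μ := 0)).2
      (by rw [Polynomial.IsRoot, ← Polynomial.coeff_zero_eq_eval_zero]; exact h0)
    obtain ⟨v, hv⟩ := this.exists_hasEigenvector
    exact hv.2 (hinj (by simpa using hv.apply_eq_smul))
  have hp : Polynomial.aeval A p * T = 0 := by
    have := haeval p ⟨T, (hE T).2 h⟩
    rw [minpoly.aeval] at this
    simpa using this.symm
  -- Solve `p(A) T = 0` for `T`, writing `p = X * p.divX + p.coeff 0`.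
  refine ⟨-(p.coeff 0)⁻¹ • Polynomial.aeval A p.divX, ?_⟩
  rw [← Polynomial.X_mul_divX_add p] at hp
  simp only [map_add, map_mul, Polynomial.aeval_X, Polynomial.aeval_C, add_mul,
    Algebra.algebraMap_eq_smul_one, smul_mul_assoc, one_mul] at hp
  rw [mul_smul_comm, smul_mul_assoc, eq_neg_of_add_eq_zero_left hp]
  rw [neg_smul, smul_neg, neg_neg, smul_smul, inv_mul_cancel₀ hc, one_smul]

/-- An operator fixed by a two-sided multiplication by compact operators has finite rank. -/
theorem mem_finiteRankIdeal_of_mul_mul_eq {A B T : H →L[ℂ] H} (hA : IsCompactOperator A)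
    (hB : IsCompactOperator B) (h : A * T * B = T) : T ∈ finiteRankIdeal H := by
  obtain ⟨q, hq⟩ := exists_mul_aeval_mul_eq hA hB h
  have hAq : IsCompactOperator (A * q : H →L[ℂ] H) := hA.comp_clm q
  have := finiteDimensional_fixedPoints_of_isCompactOperator hAq
  rw [mem_finiteRankIdeal]
  refine Submodule.finiteDimensional_of_le
    (S₂ := Module.End.eigenspace ((A * q : H →L[ℂ] H) : H →ₗ[ℂ] H) 1) ?_
  rintro _ ⟨x, rfl⟩
  rw [Module.End.mem_eigenspace_iff, one_smul]
  exact congrArg (fun S : H →L[ℂ] H => S x) hq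

/-! ### Ideals of compact operators. -/

theorem finiteRankIdeal_le_of_ne_bot {I : TwoSidedIdeal (H →L[ℂ] H)} (hI : I ≠ ⊥) :
    finiteRankIdeal H ≤ I := by
  obtain ⟨T, hTI, hT0⟩ : ∃ T ∈ I, T ≠ 0 := by
    by_contra! h
    exact hI (eq_bot_iff.2 fun T hT => (TwoSidedIdeal.mem_bot _).2 (h T hT))
  obtain ⟨x, hx⟩ : ∃ x, T x ≠ 0 := by
    by_contra! h
    exact hT0 (ContinuousLinearMap.ext h)
  have hrank : ∀ u v : H, InnerProductSpace.rankOne ℂ u v ∈ I := by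
    intro u v
    have hne : inner ℂ (T x) (T x) ≠ 0 := inner_self_ne_zero.2 hx
    have : InnerProductSpace.rankOne ℂ u v =
        ((inner ℂ (T x) (T x))⁻¹ • InnerProductSpace.rankOne ℂ u (T x)) *
          (T * InnerProductSpace.rankOne ℂ x v) := by
      ext y
      simp only [InnerProductSpace.rankOne_apply, mul_apply_eq_comp, map_smul,
        smul_apply]
      rw [smul_smul, smul_smul, mul_assoc, inv_mul_cancel₀ hne, mul_one]
    rw [this]
    exact I.mul_mem_left _ _ (I.mul_mem_right _ _ hTI)
  intro F hF
  have := (mem_finiteRankIdeal F).1 hF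
  let b := stdOrthonormalBasis ℂ (LinearMap.range (F : H →ₗ[ℂ] H))
  have : F = ∑ i, InnerProductSpace.rankOne ℂ (b i : H) (star F (b i : H)) := by
    ext y
    have h := congrArg Subtype.val (b.sum_repr' ⟨F y, ⟨y, rfl⟩⟩)
    simp only [Submodule.coe_sum, Submodule.coe_smul, Submodule.coe_inner] at h
    conv_lhs => rw [← h]
    simp [ContinuousLinearMap.star_eq_adjoint, ContinuousLinearMap.adjoint_inner_left]
  rw [this]
  exact TwoSidedIdeal.finsetSum_mem I _ _ fun i _ => hrank _ _

/-- The principal semigroup ideal generated by `T`. -/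
theorem isSemigroupIdeal_principal {A : Type*} [Semigroup A] {S : Subsemigroup A} {T : A}
    (hT : T ∈ S) :
    IsSemigroupIdeal S {Z | Z = T ∨ (∃ X ∈ S, Z = X * T) ∨ (∃ Y ∈ S, Z = T * Y) ∨
      ∃ X ∈ S, ∃ Y ∈ S, Z = X * T * Y} where
  subset := by
    rintro Z (rfl | ⟨X, hX, rfl⟩ | ⟨Y, hY, rfl⟩ | ⟨X, hX, Y, hY, rfl⟩)
    · exact hT
    · exact S.mul_mem hX hT
    · exact S.mul_mem hT hY
    · exact S.mul_mem (S.mul_mem hX hT) hY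
  mul_left_mem := by
    rintro U hU Z (rfl | ⟨X, hX, rfl⟩ | ⟨Y, hY, rfl⟩ | ⟨X, hX, Y, hY, rfl⟩)
    · exact .inr (.inl ⟨U, hU, rfl⟩)
    · exact .inr (.inl ⟨U * X, S.mul_mem hU hX, (mul_assoc _ _ _).symm⟩)
    · exact .inr (.inr (.inr ⟨U, hU, Y, hY, (mul_assoc _ _ _).symm⟩))
    · exact .inr (.inr (.inr ⟨U * X, S.mul_mem hU hX, Y, hY, by simp only [mul_assoc]⟩))
  mul_right_mem := by
    rintro U hU Z (rfl | ⟨X, hX, rfl⟩ | ⟨Y, hY, rfl⟩ | ⟨X, hX, Y, hY, rfl⟩)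
    · exact .inr (.inr (.inl ⟨U, hU, rfl⟩))
    · exact .inr (.inr (.inr ⟨X, hX, U, hU, rfl⟩))
    · exact .inr (.inr (.inl ⟨Y * U, S.mul_mem hY hU, mul_assoc _ _ _⟩))
    · exact .inr (.inr (.inr ⟨X, hX, Y * U, S.mul_mem hY hU, mul_assoc _ _ _⟩))

theorem mem_finiteRankIdeal_of_isSISemigroup {I : TwoSidedIdeal (H →L[ℂ] H)}
    (hc : ∀ T ∈ I, IsCompactOperator (T : H → H)) (hI : IsSISemigroup I.toMulSubsemigroup)
    {T : H →L[ℂ] H} (hT : T ∈ I) (hne : star T ≠ T) : T ∈ finiteRankIdeal H := by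
  rw [← star_star T]
  refine star_mem_finiteRankIdeal ?_
  rcases hI _ (isSemigroupIdeal_principal (S := I.toMulSubsemigroup) hT) T (.inl rfl) with
    h | ⟨X, hX, h⟩ | ⟨Y, hY, h⟩ | ⟨X, hX, Y, hY, h⟩
  · exact absurd h hne
  · have hX : IsCompactOperator X := hc X hX
    have h' : T = star T * star X := by rw [← star_mul, ← h, star_star]
    refine mem_finiteRankIdeal_of_mul_mul_eq hX hX.star ?_
    rw [mul_assoc, ← h', ← h]
  · have hY : IsCompactOperator Y := hc Y hY
    have h' : T = star Y * star T := by rw [← star_mul, ← h, star_star]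
    refine mem_finiteRankIdeal_of_mul_mul_eq hY.star hY ?_
    rw [← h', ← h]
  · have hX : IsCompactOperator X := hc X hX
    have hY : IsCompactOperator Y := hc Y hY
    have h' : T = star Y * star T * star X := by
      rw [mul_assoc, ← star_mul, ← star_mul, ← h, star_star]
    refine mem_finiteRankIdeal_of_mul_mul_eq (A := X * star Y) (B := star X * Y)
      (hX.comp_clm (star Y)) (hX.star.comp_clm Y) ?_
    calc X * star Y * star T * (star X * Y) = X * (star Y * star T * star X) * Y := by
          simp only [mul_assoc]
      _ = star T := by rw [← h', ← h]

theorem not_isSISemigroup_of_isCompactOperator {I : TwoSidedIdeal (H →L[ℂ] H)} (hbot : I ≠ ⊥)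
    (hF : I ≠ finiteRankIdeal H) (hc : ∀ T ∈ I, IsCompactOperator (T : H → H)) :
    ¬ IsSISemigroup I.toMulSubsemigroup := by
  intro hSI
  refine hF (le_antisymm (fun T hT => ?_) (finiteRankIdeal_le_of_ne_bot hbot))
  by_cases hs : star T = T
  · by_cases h0 : T = 0
    · rw [h0]; exact (finiteRankIdeal H).zero_mem
    -- If `T ≠ 0` is selfadjoint, `i T` is not, and it has the same rank.
    have e : T = ((-Complex.I) • 1 : H →L[ℂ] H) * (Complex.I • T) := by
      simp [smul_smul]
    rw [e]
    refine (finiteRankIdeal H).mul_mem_left _ _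
      (mem_finiteRankIdeal_of_isSISemigroup hc hSI ?_ fun h => h0 ?_)
    · have := I.mul_mem_left (Complex.I • 1) T hT
      simpa using this
    · rw [star_smul, hs, Complex.star_def, Complex.conj_I, neg_smul, neg_eq_iff_add_eq_zero,
        ← add_smul, smul_eq_zero] at h
      simpa using h
  · exact mem_finiteRankIdeal_of_isSISemigroup hc hSI hT hs

/-! ### Noncompact operators on separable spaces. -/

/-- A noncompact operator is bounded below on an orthonormal sequence whose images are
orthogonal. -/
theorem exists_orthonormal_of_not_isCompactOperator {T : H →L[ℂ] H}
    (hT : ¬ IsCompactOperator T) :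
    ∃ ε > 0, ∃ e : ℕ → H, Orthonormal ℂ e ∧ (∀ n, ε ≤ ‖T (e n)‖) ∧
      Pairwise fun m n => inner ℂ (T (e m)) (T (e n)) = 0 := by
  obtain ⟨ε, hε, h⟩ : ∃ ε > 0, ∀ S : H →L[ℂ] H, IsCompactOperator S → ε < ‖T - S‖ := by
    by_contra! h
    exact hT (isCompactOperator_of_forall_approx h)
  let r : H → H → Prop := fun x y => inner ℂ x y = 0 ∧ inner ℂ (T x) (T y) = 0
  have : Std.Symm r := ⟨fun x y h => ⟨inner_eq_zero_symm.1 h.1, inner_eq_zero_symm.1 h.2⟩⟩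
  obtain ⟨e, he, hr⟩ := exists_seq_of_forall_finset_exists'
    (fun y : H => ‖y‖ = 1 ∧ ε ≤ ‖T y‖) r (by
      intro s _
      -- Orthogonality to `T* T x` is orthogonality of the images under `T`.
      have hfin : ((s : Set H) ∪ (star T * T) '' s).Finite :=
        s.finite_toSet.union (s.finite_toSet.image _)
      have := FiniteDimensional.span_of_finite ℂ hfin
      obtain ⟨y, hy, hy1, hyT⟩ := exists_norm_eq_one_mem_orthogonal hε h
        (Submodule.span ℂ ((s : Set H) ∪ (star T * T) '' s))
      refine ⟨y, ⟨hy1, hyT⟩, fun x hx => ⟨?_, ?_⟩⟩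
      · exact hy x (Submodule.subset_span (.inl hx))
      · have := hy _ (Submodule.subset_span (.inr ⟨x, hx, rfl⟩))
        rwa [mul_apply_eq_comp, ContinuousLinearMap.star_eq_adjoint,
          ContinuousLinearMap.adjoint_inner_left] at this)
  exact ⟨ε, hε, e, ⟨fun n => (he n).1, fun m n hmn => (hr hmn).1⟩, fun n => (he n).2,
    fun m n hmn => (hr hmn).2⟩

/-- On a separable Hilbert space, a noncompact operator is bounded below on the range of some
operator with domain the whole space. -/
theorem exists_mul_boundedBelow_of_not_isCompactOperator [TopologicalSpace.SeparableSpace H]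
    {T : H →L[ℂ] H} (hT : ¬ IsCompactOperator T) :
    ∃ ε > 0, ∃ W : H →L[ℂ] H, ∀ x, ε * ‖x‖ ≤ ‖(T * W) x‖ := by
  obtain ⟨ε, hε, e, he, heT, hort⟩ := exists_orthonormal_of_not_isCompactOperator hT
  obtain ⟨w, b, -⟩ := exists_hilbertBasis ℂ H
  have := b.orthonormal.countable_of_separableSpace
  obtain ⟨f, hf⟩ := exists_injective_nat w
  have hef : Orthonormal ℂ (e ∘ f) := he.comp f hf
  -- `W` is the isometry sending the basis vector `b i` to `e (f i)`.
  let W : H →L[ℂ] H := hef.orthogonalFamily.linearIsometry.toContinuousLinearMap ∘L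
    (b.repr : H →L[ℂ] _)
  refine ⟨ε, hε, W, fun x => ?_⟩
  have hx := b.hasSum_repr x
  have hTW : HasSum (fun i => b.repr x i • T (e (f i))) ((T * W) x) := by
    have := T.hasSum (hef.orthogonalFamily.hasSum_linearIsometry (b.repr x))
    simpa [Function.comp_def, W] using this
  have hfin : ∀ s : Finset w,
      ε * ‖∑ i ∈ s, b.repr x i • b i‖ ≤ ‖∑ i ∈ s, b.repr x i • T (e (f i))‖ := by
    intro s
    refine (sq_le_sq₀ (by positivity) (norm_nonneg _)).1 ?_
    rw [mul_pow, norm_sum_sq_of_pairwise_inner_eq_zero, norm_sum_sq_of_pairwise_inner_eq_zero,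
      Finset.mul_sum]
    · refine Finset.sum_le_sum fun i _ => ?_
      rw [norm_smul, norm_smul, b.orthonormal.1, mul_one, mul_pow, mul_comm]
      gcongr
      exact heT _
    · intro i j hij
      simp [hort (hf.ne hij)]
    · intro i j hij
      simp [b.orthonormal.2 hij]
  exact le_of_tendsto_of_tendsto' (hx.norm.const_mul ε) hTW.norm hfin

theorem eq_top_of_not_isCompactOperator [TopologicalSpace.SeparableSpace H]
    {I : TwoSidedIdeal (H →L[ℂ] H)} {T : H →L[ℂ] H} (hTI : T ∈ I)
    (hT : ¬ IsCompactOperator T) : I = ⊤ := by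
  obtain ⟨ε, hε, W, hW⟩ := exists_mul_boundedBelow_of_not_isCompactOperator hT
  -- Its quadratic form is `‖T W x‖² ≥ ε² ‖x‖²`.
  have hunit : IsUnit (star (T * W) * (T * W)) := by
    refine ContinuousLinearMap.isUnit_of_forall_le_norm_inner_map _ (c := (ε ^ 2).toNNReal)
      (Real.toNNReal_pos.2 (by positivity)) fun x => ?_
    rw [mul_apply_eq_comp, ContinuousLinearMap.star_eq_adjoint,
      ContinuousLinearMap.adjoint_inner_left, inner_self_eq_norm_sq_to_K]
    have := pow_le_pow_left₀ (by positivity) (hW x) 2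
    rw [mul_pow, mul_comm] at this
    simpa [Real.coe_toNNReal _ (sq_nonneg ε)] using this
  obtain ⟨u, hu⟩ := hunit
  refine I.one_mem_iff.1 ?_
  have : (1 : H →L[ℂ] H) = ↑u⁻¹ * (star (T * W) * (T * W)) := by rw [← hu]; simp
  rw [this]
  exact I.mul_mem_left _ _ (I.mul_mem_left _ _ (I.mul_mem_right _ _ hTI))

end Hilbert

theorem mainTheorem5 (H : Type*) [NormedAddCommGroup H] [InnerProductSpace ℂ H]
    [CompleteSpace H] :
    IsSISemigroup (finiteRankIdeal H).toMulSubsemigroup ∧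
    (TopologicalSpace.SeparableSpace H →
      ∀ I : TwoSidedIdeal (H →L[ℂ] H), I ≠ ⊥ → I ≠ ⊤ → I ≠ finiteRankIdeal H →
        ¬ IsSISemigroup I.toMulSubsemigroup) ∧
    (∀ I : TwoSidedIdeal (H →L[ℂ] H), I ≠ ⊥ → I ≠ finiteRankIdeal H →
      (∀ T ∈ I, IsCompactOperator (T : H → H)) →
        ¬ IsSISemigroup I.toMulSubsemigroup) := by
  refine ⟨isSISemigroup_finiteRankIdeal, fun _ I hbot htop hF => ?_, fun I hbot hF hc =>
    not_isSISemigroup_of_isCompactOperator hbot hF hc⟩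
  refine not_isSISemigroup_of_isCompactOperator hbot hF fun T hT => ?_
  by_contra hTc
  exact htop (eq_top_of_not_isCompactOperator hT hTc)
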